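/- A (finite) word is square-free if it cannot be written as $UXXV$ with $X$ a nonempty word. A square-free word $W$ over an alphabet $\mathbb{A}$ is extendable at the position given by a factorization $W=W'W''$ if $W'xW''$ is square-free for some letter $x\in\mathbb{A}$; the position is inner if both $W'$ and $W''$ are nonempty. For every integer $t\geqslant 87$ there exists a square-free word $W$ over a $5$-letter alphabet, of length at least $t+1$ (so that it has at least $t$ inner positions), which is non-extendable at any of its $t$ rightmost inner positions; that is, for every factorization $W=W'W''$ with $1\leqslant |W''|\leqslant t$ and every letter $x$ of the $5$-letter alphabet, the word $W'xW''$ contains a square. -/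

import Mathlib

namespace SquareFreeWords

/-- A word (a list of letters) is square-free if it cannot be written as `U X X V`
with `X` nonempty. -/
def SquareFree {α : Type*} (W : List α) : Prop :=
  ∀ U X V : List α, W = U ++ X ++ X ++ V → X = []

/-- The positions of a word `W`, i.e. the places where a letter can be inserted, correspond to
the factorizations `W = W' W''`, and we index them from the right by `k = |W''|`.
`W` is extendable at position `k` if some letter `x` of the alphabet can be inserted there so
that the extension `W' x W''` is square-free. The position is inner (both `W'` and `W''` are
nonempty) exactly when `1 ≤ k < |W|`. -/
def ExtendableAt {α : Type*} (W : List α) (k : ℕ) : Prop :=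
  ∃ (W' W'' : List α) (x : α), W = W' ++ W'' ∧ W''.length = k ∧ SquareFree (W' ++ x :: W'')

end SquareFreeWords

/-!
Take a square-free word `E = s G e` in which the ternary word `G` contains neither `s` nor `e`, and
let `𝓜` be the finite set of all square-free words that arise by inserting a letter into `E` at one
of the positions in question. Let `Z` be the Zimin word on the letters `𝓜`, and let `W` be the
concatenation of the blocks of the square-free word `Z E`. Inserting a letter into the last block
`E` of `W` either creates a square inside that block or replaces it by some `B ∈ 𝓜`; but `Z B` ends
with a square.

`W` itself is square-free. The factor `e s` occurs only at the boundaries between blocks, so a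
square in `W` is either contained in few blocks or aligned with them, which would give a square of
blocks in `Z E` unless the block at the centre of the square, cut into `v` and `u`, differs both
from a block ending with `u` and from a block starting with `v`. For `B ∈ 𝓜` this is impossible:
the inserted letter lies in `v` or in `u`, and the part of `B` up to, or from, the inserted letter
occurs at the corresponding end of no other block.
-/

namespace SquareFreeWords

section Words

variable {α β : Type*}

theorem SquareFree.of_infix {W T : List α} (hW : SquareFree W) (h : T <:+: W) : SquareFree T := by
  obtain ⟨A, B, rfl⟩ := h
  intro U X V hT
  exact hW (A ++ U) X (V ++ B) (by simp [hT])

theorem not_squareFree_of_square_infix {W X : List α} (hX : X ≠ []) (h : X ++ X <:+: W) :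
    ¬ SquareFree W := fun hW =>
  hX (hW.of_infix h [] X [] (by simp))

theorem squareFree_nil : SquareFree ([] : List α) := by
  intro U X V h
  simp_all

theorem SquareFree.map {f : α → β} (hf : f.Injective) {W : List α} (hW : SquareFree W) :
    SquareFree (W.map f) := by
  intro U X V h
  simp only [List.map_eq_append_iff] at h
  obtain ⟨_, V', rfl, ⟨_, X₂, rfl, ⟨U', X₁, rfl, rfl, hX₁⟩, hX₂⟩, rfl⟩ := h
  obtain rfl : X₁ = X₂ := hf.list_map (hX₁.trans hX₂.symm)
  simp [← hX₁, hW U' X₁ V' rfl]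

theorem SquareFree.append_cons {a : α} {A B : List α} (hA : SquareFree A) (hB : SquareFree B)
    (haA : a ∉ A) (haB : a ∉ B) : SquareFree (A ++ a :: B) := by
  have split_at {P Q : List α} (h : A ++ a :: B = P ++ a :: Q) : A = P ∧ B = Q := by
    simpa using (List.append_cons_inj_of_notMem haA haB).1 h
  intro U X V h
  have ha : a ∈ U ++ X ++ X ++ V := h ▸ by simp
  simp only [List.mem_append, or_assoc, or_self_left] at ha
  rcases ha with ha | ha | ha <;> obtain ⟨P, Q, rfl⟩ := List.append_of_mem ha
  · exact hB Q X V (by simp [(split_at (P := P) (Q := Q ++ X ++ X ++ V) (by simp [h])).2])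
  · refine absurd ?_ haB
    simp [(split_at (P := U ++ P) (Q := Q ++ P ++ a :: Q ++ V) (by simp [h])).2]
  · exact hA U X P (split_at (P := U ++ X ++ X ++ P) (Q := Q) (by simp [h])).1

theorem squareFree_map_range {f : ℕ → α}
    (hf : ∀ p, 0 < p → ∀ i, ∃ j, i ≤ j ∧ j < i + p ∧ f j ≠ f (j + p)) (n : ℕ) :
    SquareFree ((List.range n).map f) := by
  intro U X V h
  by_contra hX
  obtain ⟨j, hUj, hjX, hne⟩ := hf X.length (List.length_pos_iff.2 hX) U.length
  have hn : n = U.length + X.length + X.length + V.length := by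
    simpa [add_assoc] using congrArg List.length h
  have letter_eq {j : ℕ} (hj : j < n) : (U ++ X ++ X ++ V)[j]? = some (f j) := by
    rw [← h]; simp [hj]
  have hperiod : (U ++ X ++ X ++ V)[j]? = (U ++ X ++ X ++ V)[j + X.length]? := by grind
  rw [letter_eq (by omega), letter_eq (by omega)] at hperiod
  exact hne (Option.some.inj hperiod)

end Words

section ThueMorse

/-- The Thue–Morse sequence: the parity of the sum of the binary digits. -/
def thueMorse : ℕ → Bool :=
  Nat.binaryRec false fun b _ τ => b ^^ τ

theorem thueMorse_two_mul (n : ℕ) : thueMorse (2 * n) = thueMorse n := by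
  simpa [thueMorse] using Nat.binaryRec_eq (motive := fun _ => Bool) (zero := false)
    (bit := fun b _ τ => b ^^ τ) false n (Or.inl rfl)

theorem thueMorse_two_mul_add_one (n : ℕ) : thueMorse (2 * n + 1) = !thueMorse n := by
  simpa [thueMorse] using Nat.binaryRec_eq (motive := fun _ => Bool) (zero := false)
    (bit := fun b _ τ => b ^^ τ) true n (Or.inl rfl)

theorem thueMorse_two_mul_ne (n : ℕ) : thueMorse (2 * n) ≠ thueMorse (2 * n + 1) := by
  simp [thueMorse_two_mul, thueMorse_two_mul_add_one]

theorem thueMorse_eq_succ_of_ne {n : ℕ}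
    (h : thueMorse (2 * n + 1) ≠ thueMorse (2 * n + 2)) : thueMorse n = thueMorse (n + 1) := by
  rw [← mul_add_one, thueMorse_two_mul, thueMorse_two_mul_add_one] at h
  simpa using h

theorem thueMorse_not_cube (n : ℕ) :
    ¬ (thueMorse n = thueMorse (n + 1) ∧ thueMorse (n + 1) = thueMorse (n + 2)) := by
  rintro ⟨h₁, h₂⟩
  obtain ⟨a, rfl | rfl⟩ := Nat.even_or_odd' n
  · exact thueMorse_two_mul_ne a h₁
  · exact thueMorse_two_mul_ne (a + 1) h₂

theorem thueMorse_no_odd_overlap {q : ℕ} (hq : 0 < q) (i : ℕ) :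
    ¬ ∀ j, i ≤ j → j ≤ i + (2 * q + 1) → thueMorse j = thueMorse (j + (2 * q + 1)) := by
  intro h
  obtain ⟨a, rfl | rfl⟩ := Nat.even_or_odd' i
  · have shifted_eq {b : ℕ} (hab : a ≤ b) (hba : b ≤ a + 1) :
        thueMorse (b + q) = thueMorse (b + q + 1) := by
      have h₁ := h (2 * b) (by omega) (by omega)
      have h₂ := h (2 * b + 1) (by omega) (by omega)
      apply thueMorse_eq_succ_of_ne
      convert thueMorse_two_mul_ne b using 1
      · rw [h₁]; ring_nf
      · rw [h₂]; ring_nf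
    refine thueMorse_not_cube (a + q) ⟨shifted_eq le_rfl (by omega), ?_⟩
    simpa only [add_right_comm] using shifted_eq (b := a + 1) (by omega) le_rfl
  · have unshifted_eq {b : ℕ} (hab : a ≤ b) (hba : b ≤ a + 1) :
        thueMorse b = thueMorse (b + 1) := by
      apply thueMorse_eq_succ_of_ne
      rw [h (2 * b + 1) (by omega) (by omega), h (2 * b + 2) (by omega) (by omega)]
      convert thueMorse_two_mul_ne (b + q + 1) using 2 <;> ring
    exact thueMorse_not_cube a
      ⟨unshifted_eq le_rfl (by omega), unshifted_eq (b := a + 1) (by omega) le_rfl⟩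

theorem thueMorse_no_overlap {p : ℕ} (hp : 0 < p) (i : ℕ) :
    ¬ ∀ j, i ≤ j → j ≤ i + p → thueMorse j = thueMorse (j + p) := by
  induction p using Nat.strong_induction_on generalizing i with
  | _ p ih =>
    intro h
    obtain ⟨q, rfl | rfl⟩ := Nat.even_or_odd' p
    · obtain ⟨a, rfl | rfl⟩ := Nat.even_or_odd' i <;>
        refine ih q (by omega) (by omega) a fun j hj hj' => ?_
      · simpa only [← mul_add, thueMorse_two_mul] using h (2 * j) (by omega) (by omega)
      · simpa only [add_right_comm _ 1, ← mul_add, thueMorse_two_mul_add_one, Bool.not_inj_iff]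
          using h (2 * j + 1) (by omega) (by omega)
    · rcases Nat.eq_zero_or_pos q with rfl | hq
      · exact thueMorse_not_cube i ⟨h i le_rfl (by omega), h (i + 1) (by omega) (by omega)⟩
      · exact thueMorse_no_odd_overlap hq i h

/-- The ternary Thue–Morse sequence, which records whether the Thue–Morse sequence increases,
stays or decreases. -/
def ternaryThueMorse (n : ℕ) : Ordering :=
  cmp (thueMorse n) (thueMorse (n + 1))

theorem exists_ternaryThueMorse_ne {p : ℕ} (hp : 0 < p) (i : ℕ) :
    ∃ j, i ≤ j ∧ j < i + p ∧ ternaryThueMorse j ≠ ternaryThueMorse (j + p) := by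
  by_contra! h
  have cmp_transpose : ∀ a b a' b' : Bool, cmp a b = cmp a' b' → cmp a a' = cmp b b' := by decide
  have eq_of_cmp_eq : ∀ a b c : Bool, cmp a b = cmp b c → a = b := by decide
  have cmp_shift_eq (k : ℕ) (hk : k ≤ p) : cmp (thueMorse i) (thueMorse (i + p)) =
      cmp (thueMorse (i + k)) (thueMorse (i + k + p)) := by
    induction k with
    | zero => rfl
    | succ k ih =>
      rw [ih (by omega)]
      apply cmp_transpose
      simpa only [ternaryThueMorse, add_right_comm _ p 1, ← add_assoc] using
        h (i + k) (by omega) (by omega)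
  have hip : thueMorse i = thueMorse (i + p) := eq_of_cmp_eq _ _ _ (cmp_shift_eq p le_rfl)
  refine thueMorse_no_overlap hp i fun j hij hji => ?_
  have hj := cmp_shift_eq (j - i) (by omega)
  rw [Nat.add_sub_cancel' hij, ← hip, cmp_self_eq_eq] at hj
  exact (cmp_eq_eq_iff _ _).1 hj.symm

end ThueMorse

section BlockCode

variable {α : Type*} {s e : α} {𝓑 : Set (List α)} {l l' : List (List α)} {B U V X u v : List α}

/-- A set of words that may be substituted for the letters of a square-free word. The factor `e s`
marks the boundaries in a concatenation of blocks, since every block starts with `s`, ends with `e`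
and does not contain `e s`. -/
structure IsBlockCode (s e : α) (𝓑 : Set (List α)) : Prop where
  head : ∀ B ∈ 𝓑, [s] <+: B
  last : ∀ B ∈ 𝓑, [e] <:+ B
  no_boundary : ∀ B ∈ 𝓑, ¬ [e, s] <:+: B
  squareFree : ∀ B ∈ 𝓑, SquareFree B
  eq_of_overlap : ∀ A ∈ 𝓑, ∀ C ∈ 𝓑, ∀ X ≠ [], X <:+ A → X <+: C → A = C

/-- `M` is unsplittable over `𝓑` if, however it is cut into `v` and `u`, a word of `𝓑` that ends
with `u` and a word of `𝓑` that starts with `v` cannot both differ from `M`. In a concatenation of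
blocks, this excludes a square with centre between `v` and `u` whose outer ends lie in two blocks
different from `M`. -/
def IsUnsplittable (𝓑 : Set (List α)) (M : List α) : Prop :=
  ∀ v u, M = v ++ u → ∀ A ∈ 𝓑, ∀ C ∈ 𝓑, u <:+ A → v <+: C → A = M ∨ C = M

theorem boundary_infix_append (hu : [e] <:+ u) (hv : [s] <+: v) : [e, s] <:+: u ++ v := by
  obtain ⟨u, rfl⟩ := hu
  obtain ⟨v, rfl⟩ := hv
  exact ⟨u, v, by simp⟩

theorem singleton_prefix_of_prefix (hB : [s] <+: B) (hv : v <+: B) (hne : v ≠ []) : [s] <+: v :=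
  List.prefix_of_prefix_length_le hB hv (List.length_pos_iff.2 hne)

theorem singleton_suffix_of_suffix (hB : [e] <:+ B) (hu : u <:+ B) (hne : u ≠ []) : [e] <:+ u :=
  List.suffix_of_suffix_length_le hB hu (List.length_pos_iff.2 hne)

namespace IsBlockCode

theorem ne_nil (h𝓑 : IsBlockCode s e 𝓑) (hB : B ∈ 𝓑) : B ≠ [] := by
  rintro rfl
  simpa using h𝓑.head _ hB

theorem singleton_prefix_of_prefix_flatten (h𝓑 : IsBlockCode s e 𝓑) (hl : ∀ B ∈ l, B ∈ 𝓑)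
    (hv : v <+: l.flatten) (hne : v ≠ []) : [s] <+: v := by
  cases l with
  | nil => simp_all
  | cons B l =>
    exact singleton_prefix_of_prefix ((h𝓑.head B (hl B (by simp))).trans (by simp)) hv hne

theorem singleton_suffix_of_suffix_flatten (h𝓑 : IsBlockCode s e 𝓑) (hl : ∀ B ∈ l, B ∈ 𝓑)
    (hu : u <:+ l.flatten) (hne : u ≠ []) : [e] <:+ u := by
  rcases List.eq_nil_or_concat l with rfl | ⟨l, B, rfl⟩
  · simp_all
  · exact singleton_suffix_of_suffix ((h𝓑.last B (hl B (by simp))).trans (by simp)) hu hne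

theorem prefix_head_of_no_boundary (h𝓑 : IsBlockCode s e 𝓑) (hl : ∀ C ∈ B :: l, C ∈ 𝓑)
    (hv : v <+: (B :: l).flatten) (hvb : ¬ [e, s] <:+: v) : v <+: B := by
  rw [List.forall_mem_cons] at hl
  rcases List.prefix_or_prefix_of_prefix hv (List.prefix_append B l.flatten) with hvB | ⟨w, rfl⟩
  · exact hvB
  · rcases eq_or_ne w [] with rfl | hw
    · simp
    · exact absurd (boundary_infix_append (h𝓑.last B hl.1) (h𝓑.singleton_prefix_of_prefix_flatten
        hl.2 ((List.prefix_append_right_inj B).1 hv) hw)) hvb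

theorem suffix_last_of_no_boundary (h𝓑 : IsBlockCode s e 𝓑) (hl : ∀ C ∈ l ++ [B], C ∈ 𝓑)
    (hu : u <:+ (l ++ [B]).flatten) (hub : ¬ [e, s] <:+: u) : u <:+ B := by
  rw [List.forall_mem_append, List.forall_mem_singleton] at hl
  rw [List.flatten_concat] at hu
  rcases List.suffix_or_suffix_of_suffix hu (List.suffix_append l.flatten B) with huB | ⟨w, rfl⟩
  · exact huB
  · rcases eq_or_ne w [] with rfl | hw
    · simp
    · exact absurd (boundary_infix_append (h𝓑.singleton_suffix_of_suffix_flatten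
        hl.1 (List.suffix_append_self_iff.1 hu) hw) (h𝓑.head B hl.2)) hub

theorem prefix_of_flatten_prefix (h𝓑 : IsBlockCode s e 𝓑) (hl : ∀ B ∈ l, B ∈ 𝓑)
    (hl' : ∀ B ∈ l', B ∈ 𝓑) (h : l.flatten <+: l'.flatten) : l <+: l' := by
  induction l generalizing l' with
  | nil => simp
  | cons B l ih =>
    have hB := h𝓑.ne_nil (hl B (by simp))
    cases l' with
    | nil => simp_all
    | cons C l' =>
      rw [List.forall_mem_cons] at hl hl'
      obtain rfl : B = C := by
        rcases List.prefix_or_prefix_of_prefix ((List.prefix_append B l.flatten).trans h)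
          (List.prefix_append C l'.flatten) with hBC | hCB
        · exact h𝓑.eq_of_overlap B hl.1 C hl'.1 B hB List.suffix_rfl hBC
        · exact (h𝓑.eq_of_overlap C hl'.1 B hl.1 C (h𝓑.ne_nil hl'.1) List.suffix_rfl hCB).symm
      exact (List.prefix_cons_inj B).2
        (ih hl.2 hl'.2 ((List.prefix_append_right_inj B).1 h))

theorem exists_append_of_flatten_eq_append (h𝓑 : IsBlockCode s e 𝓑) (hl : ∀ B ∈ l, B ∈ 𝓑)
    (h : l.flatten = u ++ v) (hu : [e] <:+ u) (hv : v ≠ [] → [s] <+: v) :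
    ∃ l₁ l₂, l = l₁ ++ l₂ ∧ u = l₁.flatten ∧ v = l₂.flatten := by
  rcases List.flatten_eq_append_iff.1 h with hcut | ⟨l₁, w, a, w', l₂, rfl, rfl, rfl⟩
  · exact hcut
  · rcases eq_or_ne w [] with rfl | hw
    · exact ⟨l₁, (a :: w') :: l₂, by simp⟩
    · have he := singleton_suffix_of_suffix hu (List.suffix_append _ w) hw
      have hs := singleton_prefix_of_prefix (hv (by simp)) (List.prefix_append (a :: w') _)
        (by simp)
      exact absurd (boundary_infix_append he hs) (h𝓑.no_boundary _ (hl _ (by simp)))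

theorem exists_cut_block (h𝓑 : IsBlockCode s e 𝓑) (hl : ∀ B ∈ l, B ∈ 𝓑)
    (h : l.flatten = U ++ V) (hV : V ≠ []) :
    ∃ l₁ v u l₂, l = l₁ ++ (v ++ u) :: l₂ ∧ u ≠ [] ∧ U = l₁.flatten ++ v ∧
      V = u ++ l₂.flatten := by
  rcases List.flatten_eq_append_iff.1 h with
    ⟨l₁, _ | ⟨M, l₂⟩, rfl, rfl, rfl⟩ | ⟨l₁, v, a, u, l₂, rfl, rfl, rfl⟩
  · simp at hV
  · exact ⟨l₁, [], M, l₂, by simp, h𝓑.ne_nil (hl M (by simp)), by simp⟩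
  · exact ⟨l₁, v, a :: u, l₂, by simp⟩

section Square

variable {l₁ l₂ : List (List α)} {c : List α}

-- Otherwise `X X` is a square whose centre cuts the block `v u` and which ends in that block.
theorem not_suffix_of_prefix (h𝓑 : IsBlockCode s e 𝓑)
    (hl : ∀ B ∈ l₁ ++ (v ++ u) :: l₂, B ∈ 𝓑) (hsf : SquareFree (l₁ ++ (v ++ u) :: l₂))
    (hX : X ≠ []) (hpre : X <+: u) : ¬ X <:+ l₁.flatten ++ v := by
  intro hsuf
  have hM : v ++ u ∈ 𝓑 := hl _ (by simp)
  have hXM : ¬ [e, s] <:+: X := fun hb => h𝓑.no_boundary _ hM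
    (hb.trans (hpre.isInfix.trans (List.suffix_append v u).isInfix))
  have hl₁ : ∀ B ∈ l₁, B ∈ 𝓑 := fun B hB => hl B (by simp [hB])
  rcases List.suffix_or_suffix_of_suffix hsuf (List.suffix_append _ v) with ⟨w, rfl⟩ | ⟨a, rfl⟩
  · obtain ⟨c, rfl⟩ := hpre
    exact hX (h𝓑.squareFree _ hM w X c (by simp))
  rcases eq_or_ne v [] with rfl | hv
  · rw [List.append_nil, List.append_nil] at hsuf
    rw [List.append_nil] at hX hpre hXM
    rcases List.eq_nil_or_concat l₁ with rfl | ⟨l₁, A, rfl⟩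
    · simp_all
    rw [List.concat_eq_append] at *
    obtain rfl : A = u := h𝓑.eq_of_overlap A (hl₁ A (by simp)) u hM a hX
      (h𝓑.suffix_last_of_no_boundary hl₁ hsuf hXM) hpre
    exact not_squareFree_of_square_infix (X := [A]) (by simp) ⟨l₁, l₂, by simp⟩ hsf
  rcases eq_or_ne a [] with rfl | ha
  · obtain ⟨c, rfl⟩ := hpre
    exact hX (h𝓑.squareFree _ hM [] v c (by simp))
  · refine hXM (boundary_infix_append (h𝓑.singleton_suffix_of_suffix_flatten hl₁ ?_ ha)
      (singleton_prefix_of_prefix (h𝓑.head _ hM) (List.prefix_append v u) hv))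
    exact List.suffix_append_self_iff.1 hsuf

-- Both halves `u c` of the square with centre in the block `v u` turn out to consist of `u`, the
-- same blocks `k`, and `v`.
theorem exists_blocks_of_square (h𝓑 : IsBlockCode s e 𝓑)
    (hl : ∀ B ∈ l₁ ++ (v ++ u) :: l₂, B ∈ 𝓑) (hu : u ≠ []) (hc : c ≠ [])
    (hpre : c <+: l₂.flatten) (hsuf : u ++ c <:+ l₁.flatten ++ v) :
    ∃ k m, c = k.flatten ++ v ∧ l₁ = m ++ k ∧ u <:+ m.flatten := by
  have hM : v ++ u ∈ 𝓑 := hl _ (by simp)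
  have hl₁ : ∀ B ∈ l₁, B ∈ 𝓑 := fun B hB => hl B (by simp [hB])
  have hl₂ : ∀ B ∈ l₂, B ∈ 𝓑 := fun B hB => hl B (by simp [hB])
  have hue : [e] <:+ u := singleton_suffix_of_suffix (h𝓑.last _ hM) (List.suffix_append v u) hu
  have hnot_infix : ¬ u ++ c <:+: v ++ u := fun h => h𝓑.no_boundary _ hM
    ((boundary_infix_append hue (h𝓑.singleton_prefix_of_prefix_flatten hl₂ hpre hc)).trans h)
  rcases List.suffix_or_suffix_of_suffix hsuf (List.suffix_append _ v) with h | ⟨a, ha⟩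
  · exact absurd (h.isInfix.trans (List.prefix_append v u).isInfix) hnot_infix
  have ha₁ : a <:+ l₁.flatten := List.suffix_append_self_iff.1 (ha ▸ hsuf)
  have hreach : ∃ d, a = u ++ d ∧ c = d ++ v := by
    rcases List.append_eq_append_iff.1 ha with ⟨d, rfl, rfl⟩ | hd
    · rcases eq_or_ne d [] with rfl | hd
      · exact ⟨[], by simp⟩
      have hds : [s] <+: d := singleton_prefix_of_prefix (h𝓑.head _ hM) (by simp) hd
      have hae : [e] <:+ a := by
        refine h𝓑.singleton_suffix_of_suffix_flatten hl₁ ha₁ fun ha => hnot_infix ?_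
        simpa [ha] using (List.prefix_append (d ++ c) d).isInfix
      exact absurd ((boundary_infix_append hae hds).trans (List.suffix_append _ _).isInfix)
        (h𝓑.no_boundary _ hM)
    · exact hd
  obtain ⟨d, rfl, rfl⟩ := hreach
  obtain ⟨w, hw⟩ := ha₁
  obtain ⟨m, k, rfl, hm, rfl⟩ := h𝓑.exists_append_of_flatten_eq_append (u := w ++ u) (v := d) hl₁
    (by simp [hw]) (hue.trans (List.suffix_append _ _))
    (h𝓑.singleton_prefix_of_prefix_flatten hl₂ ((List.prefix_append d v).trans hpre))
  exact ⟨k, m, rfl, rfl, w, hm⟩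

theorem not_suffix_of_append (h𝓑 : IsBlockCode s e 𝓑)
    (hl : ∀ B ∈ l₁ ++ (v ++ u) :: l₂, B ∈ 𝓑) (hsf : SquareFree (l₁ ++ (v ++ u) :: l₂))
    (hM : IsUnsplittable 𝓑 (v ++ u)) (hu : u ≠ []) (hc : c ≠ [])
    (hpre : c <+: l₂.flatten) : ¬ u ++ c <:+ l₁.flatten ++ v := by
  intro hsuf
  obtain ⟨k, m, rfl, rfl, hum⟩ := h𝓑.exists_blocks_of_square hl hu hc hpre hsuf
  simp only [List.forall_mem_append, List.forall_mem_cons] at hl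
  obtain ⟨⟨hm, hk⟩, hvu, hl₂⟩ := hl
  obtain ⟨l₃, rfl⟩ : k <+: l₂ :=
    h𝓑.prefix_of_flatten_prefix hk hl₂ ((List.prefix_append _ v).trans hpre)
  rw [List.flatten_append, List.prefix_append_right_inj] at hpre
  rw [List.forall_mem_append] at hl₂
  rcases List.eq_nil_or_concat m with rfl | ⟨m, B, rfl⟩
  · simp_all
  rw [List.concat_eq_append] at *
  have huB : u <:+ B := h𝓑.suffix_last_of_no_boundary hm hum fun h =>
    h𝓑.no_boundary _ hvu (h.trans (List.suffix_append v u).isInfix)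
  have hnot_left : B ≠ v ++ u := by
    rintro rfl
    exact not_squareFree_of_square_infix (X := (v ++ u) :: k) (by simp) ⟨m, l₃, by simp⟩ hsf
  cases l₃ with
  | nil =>
    obtain rfl : v = [] := by simpa using hpre
    have hBM := hM [] u rfl B (hm B (by simp)) B (hm B (by simp)) huB List.nil_prefix
    exact hnot_left (or_self_iff.1 hBM)
  | cons C l₃ =>
    have hvC : v <+: C := h𝓑.prefix_head_of_no_boundary hl₂.2 hpre fun h =>
      h𝓑.no_boundary _ hvu (h.trans (List.prefix_append v u).isInfix)
    rcases hM v u rfl B (hm B (by simp)) C (hl₂.2 C (by simp)) huB hvC with h | rfl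
    · exact hnot_left h
    · exact not_squareFree_of_square_infix (X := k ++ [v ++ u]) (by simp)
        ⟨m ++ [B], l₃, by simp⟩ hsf

end Square

theorem squareFree_flatten (h𝓑 : IsBlockCode s e 𝓑) (hl : ∀ B ∈ l, B ∈ 𝓑) (hsf : SquareFree l)
    (hunsplit : ∀ M ∈ l.dropLast, IsUnsplittable 𝓑 M) : SquareFree l.flatten := by
  intro U X V h
  by_contra hX
  obtain ⟨l₁, v, u, l₂, rfl, hu, hU, hV⟩ :=
    h𝓑.exists_cut_block (U := U ++ X) (V := X ++ V) hl (by simp [h]) (by simp [hX])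
  have hsuf : X <:+ l₁.flatten ++ v := ⟨U, hU⟩
  rcases List.append_eq_append_iff.1 hV with ⟨c, rfl, -⟩ | ⟨c, rfl, hc⟩
  · exact h𝓑.not_suffix_of_prefix hl hsf hX (by simp) hsuf
  rcases eq_or_ne c [] with rfl | hcne
  · exact h𝓑.not_suffix_of_prefix hl hsf hX (by simp) hsuf
  have hl₂ : l₂ ≠ [] := by
    rintro rfl
    simp_all
  refine h𝓑.not_suffix_of_append hl hsf (hunsplit _ ?_) hu hcne ⟨V, hc.symm⟩ hsuf
  simp [List.dropLast_append_of_ne_nil, List.dropLast_cons_of_ne_nil hl₂]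

theorem not_squareFree_flatten (h𝓑 : IsBlockCode s e 𝓑) (hl : ∀ B ∈ l, B ∈ 𝓑)
    (hsq : ¬ SquareFree l) : ¬ SquareFree l.flatten := by
  simp only [SquareFree, not_forall] at hsq
  obtain ⟨U, X, V, rfl, hX⟩ := hsq
  refine not_squareFree_of_square_infix (X := X.flatten) ?_ ⟨U.flatten, V.flatten, by simp⟩
  obtain ⟨B, hB⟩ := List.exists_mem_of_ne_nil X hX
  exact fun h => h𝓑.ne_nil (hl B (by simp [hB])) (List.flatten_eq_nil_iff.1 h B hB)

end IsBlockCode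

end BlockCode

section Zimin

variable {β : Type*} {b : β} {bs : List β}

/-- The Zimin word on a list of letters: `Z(b, bs) = Z(bs) b Z(bs)`. -/
def zimin : List β → List β
  | [] => []
  | b :: bs => zimin bs ++ b :: zimin bs

theorem mem_of_mem_zimin (h : b ∈ zimin bs) : b ∈ bs := by
  induction bs with
  | nil => exact h
  | cons c bs ih =>
    simp only [zimin, List.mem_append, List.mem_cons] at h ⊢
    tauto

theorem squareFree_zimin (h : bs.Nodup) : SquareFree (zimin bs) := by
  induction bs with
  | nil => exact squareFree_nil
  | cons b bs ih =>
    rw [List.nodup_cons] at h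
    exact (ih h.2).append_cons (ih h.2) (h.1 ∘ mem_of_mem_zimin) (h.1 ∘ mem_of_mem_zimin)

theorem not_squareFree_zimin_append_singleton (h : b ∈ bs) : ¬ SquareFree (zimin bs ++ [b]) := by
  induction bs with
  | nil => simp at h
  | cons c bs ih =>
    rcases List.mem_cons.1 h with rfl | h
    · exact not_squareFree_of_square_infix (X := zimin bs ++ [b]) (by simp) (by simp [zimin])
    · exact fun hsf => ih h (hsf.of_infix ⟨zimin bs ++ [c], [], by simp [zimin]⟩)

end Zimin

section Insertion

variable {α : Type*} {s e x : α} {t : ℕ} {B C E P R X : List α}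

/-- `B` is a square-free word obtained by inserting a letter into `E` at a position with at least
one and at most `t` letters of `E` to its right. -/
def IsInsertion (E : List α) (t : ℕ) (B : List α) : Prop :=
  ∃ P x R, E = P ++ R ∧ R ≠ [] ∧ R.length ≤ t ∧ B = P ++ x :: R ∧ SquareFree B

theorem IsInsertion.length_eq (h : IsInsertion E t B) : B.length = E.length + 1 := by
  obtain ⟨P, x, R, rfl, -, -, rfl, -⟩ := h
  simp [add_assoc]

theorem finite_setOf_isInsertion [Finite α] (E : List α) (t : ℕ) :
    {B | IsInsertion E t B}.Finite :=
  (List.finite_length_eq α (E.length + 1)).subset fun _ hB => hB.length_eq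

theorem not_prefix_of_squareFree_insertion (h : SquareFree (P ++ x :: R)) :
    ¬ P ++ [x] <+: P ++ R := by
  rw [List.prefix_append_right_inj]
  rintro ⟨R, rfl⟩
  exact not_squareFree_of_square_infix (X := [x]) (by simp) ⟨P, R, by simp⟩ h

theorem not_suffix_of_squareFree_insertion (h : SquareFree (P ++ x :: R)) :
    ¬ x :: R <:+ P ++ R := by
  rw [← List.singleton_append]
  intro hsuf
  obtain ⟨P, rfl⟩ := List.suffix_append_self_iff.1 hsuf
  exact not_squareFree_of_square_infix (X := [x]) (by simp) ⟨P, R, by simp⟩ h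

/-- The blocks of the final word: `E` and its insertions. -/
def insertionCode (E : List α) (t : ℕ) : Set (List α) :=
  insert E {B | IsInsertion E t B}

theorem eq_insertion_of_prefix (hB : SquareFree (P ++ x :: R))
    (hC : C ∈ insertionCode (P ++ R) t) (h : P ++ [x] <+: C) : C = P ++ x :: R := by
  rcases hC with rfl | ⟨P', x', R', hE, -, -, rfl, hC⟩
  · exact absurd h (not_prefix_of_squareFree_insertion hB)
  have hP' : P' ++ [x'] <+: P' ++ x' :: R' := by simp
  rcases lt_trichotomy P.length P'.length with hlt | heq | hgt
  · have : P ++ [x] <+: P' := List.prefix_of_prefix_length_le h (by simp) (by simpa using hlt)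
    exact absurd (hE ▸ this.trans (by simp)) (not_prefix_of_squareFree_insertion hB)
  · obtain ⟨rfl, rfl⟩ := List.append_inj hE heq
    simpa [eq_comm] using List.prefix_of_prefix_length_le h hP' (by simp)
  · have : P' ++ [x'] <+: P := List.prefix_of_prefix_length_le hP'
      ((List.prefix_append P [x]).trans h) (by simpa using hgt)
    exact absurd (hE ▸ this.trans (by simp)) (not_prefix_of_squareFree_insertion hC)

theorem eq_insertion_of_suffix (hB : SquareFree (P ++ x :: R))
    (hC : C ∈ insertionCode (P ++ R) t) (h : x :: R <:+ C) : C = P ++ x :: R := by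
  rcases hC with rfl | ⟨P', x', R', hE, -, -, rfl, hC⟩
  · exact absurd h (not_suffix_of_squareFree_insertion hB)
  have hR' : x' :: R' <:+ P' ++ x' :: R' := by simp
  rcases lt_trichotomy R.length R'.length with hlt | heq | hgt
  · have : x :: R <:+ R' := List.suffix_of_suffix_length_le h
      ((List.suffix_cons x' R').trans hR') (by simpa using hlt)
    exact absurd (hE ▸ this.trans (List.suffix_append P' R'))
      (not_suffix_of_squareFree_insertion hB)
  · obtain ⟨rfl, rfl⟩ := List.append_inj' hE heq
    have := (List.suffix_of_suffix_length_le h hR' (by simp)).eq_of_length (by simp)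
    rw [this]
  · have : x' :: R' <:+ R := List.suffix_of_suffix_length_le hR'
      ((List.suffix_cons x R).trans h) (by simpa using hgt)
    exact absurd (hE ▸ this.trans (List.suffix_append P R))
      (not_suffix_of_squareFree_insertion hC)

theorem IsInsertion.isUnsplittable (hB : IsInsertion E t B) :
    IsUnsplittable (insertionCode E t) B := by
  obtain ⟨P, x, R, rfl, -, -, rfl, hsf⟩ := hB
  intro v u hvu A hA C hC hu hv
  rcases List.append_eq_append_iff.1 hvu with ⟨_ | ⟨y, w⟩, rfl, hw⟩ | ⟨w, rfl, rfl⟩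
  · exact Or.inl (eq_insertion_of_suffix hsf hA (by simpa [hw] using hu))
  · obtain ⟨rfl, rfl⟩ : x = y ∧ R = w ++ u := by simpa using hw
    refine Or.inr (eq_insertion_of_prefix hsf hC ?_)
    exact List.IsPrefix.trans (by simp) hv
  · exact Or.inl (eq_insertion_of_suffix hsf hA ((List.suffix_append w _).trans hu))

theorem eq_of_prefix_of_mem_insertionCode (hB : B ∈ insertionCode E t)
    (hC : C ∈ insertionCode E t) (h : B <+: C) : B = C := by
  rcases hB with rfl | ⟨P, x, R, rfl, -, -, rfl, hsf⟩
  · rcases hC with rfl | ⟨P, x, R, rfl, hR, -, rfl, hsf⟩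
    · rfl
    · refine absurd ?_ (not_prefix_of_squareFree_insertion hsf)
      refine List.prefix_of_prefix_length_le (by simp) h ?_
      simpa [Nat.one_le_iff_ne_zero] using hR
  · exact (eq_insertion_of_prefix hsf hC (List.IsPrefix.trans (by simp) h)).symm

theorem left_ne_nil_of_length_lt (h : R.length < (P ++ R).length) : P ≠ [] := by
  rintro rfl
  simp at h

theorem take_prefix_of_mem_insertionCode (ht : 2 * t < E.length) (hB : B ∈ insertionCode E t) :
    E.take (t + 1) <+: B := by
  rcases hB with rfl | ⟨P, x, R, rfl, -, hRt, rfl, -⟩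
  · exact List.take_prefix _ _
  · rw [List.length_append] at ht
    rw [List.take_append_of_le_length (by omega)]
    exact (List.take_prefix _ _).trans (List.prefix_append _ _)

/-- The letters `s` and `e` occur in `E` exactly once each: at the start and at the end. -/
structure IsFramed (s e : α) (E : List α) : Prop where
  head : [s] <+: E
  last : [e] <:+ E
  notMem_tail : s ∉ E.tail
  notMem_dropLast : e ∉ E.dropLast
  ne : s ≠ e

namespace IsFramed

theorem eq_of_mem_tail_insertion (hE : IsFramed s e (P ++ R)) (hP : P ≠ [])
    (h : s ∈ (P ++ x :: R).tail) : s = x := by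
  have hs := hE.notMem_tail
  simp only [List.tail_append_of_ne_nil hP, List.mem_append, List.mem_cons] at hs h
  tauto

theorem eq_of_mem_dropLast_insertion (hE : IsFramed s e (P ++ R)) (hR : R ≠ [])
    (h : e ∈ (P ++ x :: R).dropLast) : e = x := by
  have he := hE.notMem_dropLast
  simp only [List.dropLast_append_of_ne_nil hR, List.mem_append, List.mem_cons,
    List.dropLast_append_of_ne_nil (List.cons_ne_nil x R), List.dropLast_cons_of_ne_nil hR] at he h
  tauto

theorem not_boundary_infix (hE : IsFramed s e E) (ht : t < E.length)
    (hB : B ∈ insertionCode E t) : ¬ [e, s] <:+: B := by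
  rintro ⟨U, V, rfl⟩
  have hs : s ∈ (U ++ [e, s] ++ V).tail := by cases U <;> simp
  have he : e ∈ (U ++ [e, s] ++ V).dropLast := by
    rw [List.append_assoc, List.dropLast_append_of_ne_nil (by simp)]
    simp
  rcases hB with rfl | ⟨P, x, R, rfl, hR, hRt, hB, -⟩
  · exact hE.notMem_tail hs
  · rw [hB] at hs he
    exact hE.ne ((hE.eq_of_mem_tail_insertion (left_ne_nil_of_length_lt (hRt.trans_lt ht)) hs).trans
      (hE.eq_of_mem_dropLast_insertion hR he).symm)

theorem notMem_take (hE : IsFramed s e E) (ht : t < E.length) : e ∉ E.take t := fun h =>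
  hE.notMem_dropLast (List.dropLast_eq_take ▸ List.take_subset_take_left E (by omega) h)

theorem singleton_prefix_of_mem (hE : IsFramed s e E) (ht : t < E.length)
    (hB : B ∈ insertionCode E t) : [s] <+: B := by
  rcases hB with rfl | ⟨P, x, R, rfl, -, hRt, rfl, -⟩
  · exact hE.head
  · have hP : P ≠ [] := left_ne_nil_of_length_lt (hRt.trans_lt ht)
    have hsP := singleton_prefix_of_prefix hE.head (List.prefix_append P R) hP
    exact hsP.trans (List.prefix_append P _)

theorem singleton_suffix_of_mem (hE : IsFramed s e E) (hB : B ∈ insertionCode E t) :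
    [e] <:+ B := by
  rcases hB with rfl | ⟨P, x, R, rfl, hR, -, rfl, -⟩
  · exact hE.last
  · have heR := singleton_suffix_of_suffix hE.last (List.suffix_append P R) hR
    exact heR.trans ((List.suffix_cons x R).trans (List.suffix_append P _))

theorem length_le_of_suffix_tail (hE : IsFramed s e E) (ht : t < E.length)
    (hB : B ∈ insertionCode E t) (hX : [s] <+: X) (h : X <:+ B.tail) : X.length ≤ t + 1 := by
  have hsX : s ∈ X := hX.subset (by simp)
  rcases hB with rfl | ⟨P, x, R, rfl, -, hRt, rfl, -⟩
  · exact absurd (h.subset hsX) hE.notMem_tail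
  have hP : P ≠ [] := left_ne_nil_of_length_lt (hRt.trans_lt ht)
  rw [List.tail_append_of_ne_nil hP] at h
  rcases List.suffix_or_suffix_of_suffix h (List.suffix_append _ _) with h' | ⟨w, rfl⟩
  · exact h'.length_le.trans (by simpa using hRt)
  · rcases eq_or_ne w [] with rfl | hw
    · simpa using hRt
    have hsw := singleton_prefix_of_prefix hX (List.prefix_append w _) hw
    refine absurd ?_ hE.notMem_tail
    rw [List.tail_append_of_ne_nil hP]
    exact List.mem_append_left R ((List.suffix_append_self_iff.1 h).subset (hsw.subset (by simp)))

theorem isBlockCode (hE : IsFramed s e E) (hsf : SquareFree E) (ht : 2 * t + 1 < E.length) :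
    IsBlockCode s e (insertionCode E t) where
  head _ hB := hE.singleton_prefix_of_mem (by omega) hB
  last _ hB := hE.singleton_suffix_of_mem hB
  no_boundary _ hB := hE.not_boundary_infix (by omega) hB
  squareFree B hB := by
    rcases hB with rfl | ⟨_, _, _, -, -, -, -, hB⟩
    · exact hsf
    · exact hB
  eq_of_overlap A hA C hC X hX hXA hXC := by
    obtain ⟨_ | ⟨a, w⟩, rfl⟩ := hXA
    · exact eq_of_prefix_of_mem_insertionCode hA hC hXC
    exfalso
    have hsX := singleton_prefix_of_prefix (hE.singleton_prefix_of_mem (by omega) hC) hXC hX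
    have heX := singleton_suffix_of_suffix (hE.singleton_suffix_of_mem hA)
      (List.suffix_append _ X) hX
    have hXt : X <+: E.take (t + 1) := by
      refine List.prefix_of_prefix_length_le hXC (take_prefix_of_mem_insertionCode (by omega) hC) ?_
      have := hE.length_le_of_suffix_tail (by omega) hA hsX (List.suffix_append w X)
      rw [List.length_take]
      omega
    exact hE.notMem_take (by omega) (hXt.subset (heX.subset (by simp)))

end IsFramed

end Insertion

section Construction

variable {α : Type*} {t : ℕ}

theorem exists_isFramed [Fintype α] (hα : 5 ≤ Fintype.card α) (n : ℕ) :
    ∃ (s e : α) (E : List α), IsFramed s e E ∧ SquareFree E ∧ n < E.length := by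
  have hcard : Fintype.card (Option (Option Ordering)) = 5 := rfl
  obtain ⟨f⟩ := Function.Embedding.nonempty_of_card_le (hcard.trans_le hα)
  let G := ((List.range n).map ternaryThueMorse).map (f ∘ some ∘ some)
  have hG : SquareFree G := (squareFree_map_range (fun _ => exists_ternaryThueMorse_ne) n).map
    (f.injective.comp ((Option.some_injective _).comp (Option.some_injective _)))
  have hsG : f none ∉ G := by simp [G]
  have heG : f (some none) ∉ G := by simp [G]
  have hne : f none ≠ f (some none) := by simp
  refine ⟨f none, f (some none), f none :: (G ++ [f (some none)]),
    ⟨by simp, ⟨f none :: G, by simp⟩, by simp [hsG], ?_, hne⟩, ?_, by simp [G]⟩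
  · rw [← List.cons_append, List.dropLast_concat]
    simp [heG, hne.symm]
  · exact squareFree_nil.append_cons (hG.append_cons squareFree_nil heG (by simp)) (by simp)
      (by simp [hsG])

theorem exists_word_of_isFramed [Finite α] {s e : α} {E : List α} (hE : IsFramed s e E)
    (hsf : SquareFree E) (ht : 2 * t + 1 < E.length) :
    ∃ W : List α, SquareFree W ∧ E <:+ W ∧ ∀ k, 1 ≤ k → k ≤ t → ¬ ExtendableAt W k := by
  let Ms := (finite_setOf_isInsertion E t).toFinset.toList
  have mem_Ms {B : List α} : B ∈ Ms ↔ IsInsertion E t B := by simp [Ms]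
  have h𝓑 : IsBlockCode s e (insertionCode E t) := hE.isBlockCode hsf ht
  have mem_code {C : List α} (hC : C ∈ insertionCode E t) :
      ∀ B ∈ zimin Ms ++ [C], B ∈ insertionCode E t := by
    rw [List.forall_mem_append, List.forall_mem_singleton]
    exact ⟨fun B hB => Or.inr (mem_Ms.1 (mem_of_mem_zimin hB)), hC⟩
  have hEMs : E ∉ zimin Ms := fun h =>
    absurd (mem_Ms.1 (mem_of_mem_zimin h)).length_eq (by simp)
  refine ⟨(zimin Ms ++ [E]).flatten, ?_, by simp, ?_⟩
  · refine h𝓑.squareFree_flatten (mem_code (Or.inl rfl)) ?_ fun M hM => ?_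
    · exact (squareFree_zimin (Finset.nodup_toList _)).append_cons squareFree_nil hEMs (by simp)
    · rw [List.dropLast_concat] at hM
      exact (mem_Ms.1 (mem_of_mem_zimin hM)).isUnsplittable
  · rintro k hk hkt ⟨W', R, x, hW, rfl, hext⟩
    rw [List.flatten_concat] at hW
    obtain ⟨P, rfl⟩ : R <:+ E := List.suffix_of_suffix_length_le (l₃ := W' ++ R) (by simp)
      (hW ▸ List.suffix_append _ E) (by omega)
    obtain rfl : (zimin Ms).flatten ++ P = W' := List.append_cancel_right (by simpa using hW)
    have hB : IsInsertion (P ++ R) t (P ++ x :: R) := ⟨P, x, R, rfl,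
      List.length_pos_iff.1 hk, hkt, rfl, hext.of_infix ⟨(zimin Ms).flatten, [], by simp⟩⟩
    refine h𝓑.not_squareFree_flatten (mem_code (Or.inr hB))
      (not_squareFree_zimin_append_singleton (mem_Ms.2 hB)) ?_
    simpa using hext

end Construction

end SquareFreeWords

theorem proposition2p3_general {α : Type*} [Fintype α] (hα : 5 ≤ Fintype.card α) (t : ℕ) :
    ∃ W : List α, SquareFreeWords.SquareFree W ∧ t < W.length ∧
      ∀ k : ℕ, 1 ≤ k → k ≤ t → ¬ SquareFreeWords.ExtendableAt W k := by
  obtain ⟨s, e, E, hE, hsf, ht⟩ := SquareFreeWords.exists_isFramed hα (2 * t + 1)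
  obtain ⟨W, hW, hEW, hext⟩ := SquareFreeWords.exists_word_of_isFramed hE hsf ht
  have hlen : E.length ≤ W.length := hEW.length_le
  exact ⟨W, hW, by omega, hext⟩

/-- The condition `t < W.length` says that `W` has at least `t` inner positions; the `t` rightmost
ones are then those with index `k = 1, …, t`. -/
theorem proposition2p3 (t : ℕ) (ht : 87 ≤ t) :
    ∃ W : List (Fin 5), SquareFreeWords.SquareFree W ∧ t < W.length ∧
      ∀ k : ℕ, 1 ≤ k → k ≤ t → ¬ SquareFreeWords.ExtendableAt W k :=
  proposition2p3_general (by simp) t
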